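/- Let $n$ be a natural number and $f:(0,+\infty)\to\mathbb{R}$ a Lipschitz function. A domain $\Omega\subset\mathbb{R}^n$ (a nonempty connected open set, bounded or unbounded) with boundary of class $C^2$ is called $f$-extremal if there are a constant $\alpha\le 0$ and a function $u\in C^2(\overline\Omega)$ that solve the overdetermined elliptic problem $$\Delta u+f(u)=0 \text{ in }\Omega,\qquad u>0\text{ in }\Omega,\qquad u=0\text{ on }\partial\Omega,\qquad \langle\nabla u,\nu\rangle=\alpha\text{ on }\partial\Omega,\tag{1}$$ where $\nu$ is the unit normal vector to $\partial\Omega$ pointing outwards $\Omega$. Theorem. Suppose that there is a constant $\lambda>0$ such that $f(t)\ge\lambda t$ for all $t>0$. Let $\Omega\subset\mathbb{R}^2$ be an $f$-extremal domain. Then there is a constant $R>0$ with the following two properties. (T4) $\overline\Omega$ does not contain any closed ball of radius $R$. (T5) For every solution $u\in C^2(\overline\Omega)$ of (1) (for some constant $\alpha\le0$) there is a constant $h_0>0$ such that every connected component of $\{x\in\Omega : u(x)>h_0\}$ is contained in a ball of radius $\frac{\sqrt5}{2}R$. Moreover, (T4) holds in every dimension: for every $n$ and every $f$-extremal domain $\Omega\subset\mathbb{R}^n$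 there is a constant $R>0$ such that $\overline\Omega$ does not contain any closed ball of radius $R$. -/

import Mathlib

open Set Metric Topology
open scoped NNReal

/-- `ρ` is a local `C²` defining function of `Ω` at `x`: near `x`, `Ω` is `{ρ < 0}`, `ρ x = 0`, and
the gradient of `ρ` at `x` does not vanish. -/
structure IsLocalDefiningFunction {n : ℕ} (Ω : Set (EuclideanSpace ℝ (Fin n)))
    (x : EuclideanSpace ℝ (Fin n)) (ρ : EuclideanSpace ℝ (Fin n) → ℝ) : Prop where
  contDiffAt : ContDiffAt ℝ 2 ρ x
  eq_zero : ρ x = 0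
  gradient_ne_zero : gradient ρ x ≠ 0
  eventually_mem_iff : ∀ᶠ y in 𝓝 x, (y ∈ Ω ↔ ρ y < 0)

/-- The boundary of `Ω` is of class `C²`. -/
def HasC2Boundary {n : ℕ} (Ω : Set (EuclideanSpace ℝ (Fin n))) : Prop :=
  ∀ x ∈ frontier Ω, ∃ ρ, IsLocalDefiningFunction Ω x ρ

/-- `ν` is the unit normal vector to `∂Ω` at `x` that points outwards `Ω`. -/
def IsOuterUnitNormal {n : ℕ} (Ω : Set (EuclideanSpace ℝ (Fin n)))
    (x ν : EuclideanSpace ℝ (Fin n)) : Prop :=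
  ∃ ρ, IsLocalDefiningFunction Ω x ρ ∧ ν = ‖gradient ρ x‖⁻¹ • gradient ρ x

/-- A domain of `ℝⁿ` (a nonempty connected open set, bounded or not) with boundary of class `C²`. -/
structure IsC2Domain {n : ℕ} (Ω : Set (EuclideanSpace ℝ (Fin n))) : Prop where
  isOpen : IsOpen Ω
  isConnected : IsConnected Ω
  hasC2Boundary : HasC2Boundary Ω

/-- `u ∈ C²(Ω̄)` solves the overdetermined problem `Δu + f(u) = 0` and `u > 0` in `Ω`, `u = 0` and
`⟨∇u, ν⟩ = α` on `∂Ω`, where `α ≤ 0` is a constant. On `∂Ω`, the differential of `u` is the one-sided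
differential, taken from within `Ω̄`. The values of `u` off `Ω̄` are irrelevant. -/
structure IsOverdeterminedSolution {n : ℕ} (f : ℝ → ℝ) (Ω : Set (EuclideanSpace ℝ (Fin n)))
    (α : ℝ) (u : EuclideanSpace ℝ (Fin n) → ℝ) : Prop where
  nonpos : α ≤ 0
  contDiffOn : ContDiffOn ℝ 2 u (closure Ω)
  equation : ∀ x ∈ Ω, Laplacian.laplacian u x + f (u x) = 0
  pos : ∀ x ∈ Ω, 0 < u x
  dirichlet : ∀ x ∈ frontier Ω, u x = 0
  neumann : ∀ x ∈ frontier Ω, ∀ ν, IsOuterUnitNormal Ω x ν →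
    fderivWithin ℝ u (closure Ω) x ν = α

/-- `Ω` is an `f`-extremal domain: a `C²` domain in which the overdetermined problem is solvable for
some constant `α ≤ 0`. -/
structure IsFExtremal {n : ℕ} (f : ℝ → ℝ) (Ω : Set (EuclideanSpace ℝ (Fin n))) : Prop where
  isC2Domain : IsC2Domain Ω
  exists_solution : ∃ α u, IsOverdeterminedSolution f Ω α u

/-- There is a positive `lam` with `f t ≥ lam * t` for all `t > 0`. -/
def HasLinearLowerBound (f : ℝ → ℝ) : Prop :=
  ∃ lam > 0, ∀ t > 0, lam * t ≤ f t

/-- The closure of `Ω` contains no closed ball of radius `R`. -/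
def ClosureContainsNoClosedBall {n : ℕ} (Ω : Set (EuclideanSpace ℝ (Fin n))) (R : ℝ) : Prop :=
  ∀ c, ¬ closedBall c R ⊆ closure Ω

/-! No large balls: a positive function with `Δu ≤ -λu` cannot live on a large ball. This follows by
comparing `u` with `φ = (R² - |y - c|²)²` at a maximum of `φ / u`
(`not_closedBall_subset_of_laplacian_le`). Since a `C²` domain is the interior of its closure, balls
in `Ω̄` reduce to slightly smaller balls in `Ω`.

Components of superlevel sets: more is true, namely that every solution in the plane is bounded
(`IsOverdeterminedSolution.apply_le`). For `h₀` above the bound the superlevel set is empty and the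
containment is vacuous. To bound `u x`, take the largest ball around `x` inside `Ω`. Its radius `d`
is at most `R`, and it touches `∂Ω` at some `y`. By a weak Harnack inequality (`weak_harnack`), a
large `u x` makes `u` large on a concentric ball of radius proportional to `d`. A Hopf barrier
(`IsOverdeterminedSolution.hopf`) carries this to `y`, where the inward slope is exactly `-α`; hence
`u x` is controlled by `α`, `R` and the growth of `f`.

The Harnack step needs no a priori bound on `u`. The Lipschitz condition gives `f t ≤ A + K t`, and
`u` is superharmonic, so circle means of `f(u)` are controlled by the value of `u` at the center. -/

/-! ### Second derivatives at a local minimum; the Laplacian of radial functions and under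
isometries. -/

section Laplacian

open InnerProductSpace Laplacian

variable {E : Type*} [NormedAddCommGroup E] [InnerProductSpace ℝ E]

/-- The second derivative along a line. -/
theorem hasDerivAt_line_of_contDiffAt {f : E → ℝ} {x v : E} (hf : ContDiffAt ℝ 2 f x) :
    (∀ᶠ t in 𝓝 (0 : ℝ), HasDerivAt (fun s : ℝ => f (x + s • v)) (fderiv ℝ f (x + t • v) v) t) ∧
    HasDerivAt (fun s : ℝ => fderiv ℝ f (x + s • v) v) (iteratedFDeriv ℝ 2 f x ![v, v]) 0 := by
  have hl : ∀ t : ℝ, HasDerivAt (fun s : ℝ => x + s • v) v t := fun t => by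
    simpa using ((hasDerivAt_id t).smul_const v).const_add x
  have ht : Filter.Tendsto (fun s : ℝ => x + s • v) (𝓝 0) (𝓝 x) := by
    simpa using (hl 0).continuousAt.tendsto
  constructor
  · have h1 : ∀ᶠ y in 𝓝 x, DifferentiableAt ℝ f y :=
      (hf.eventually (by simp)).mono fun y hy => hy.differentiableAt (by norm_num)
    filter_upwards [ht.eventually h1] with t h
    exact h.hasFDerivAt.comp_hasDerivAt t (hl t)
  · have h2 : DifferentiableAt ℝ (fderiv ℝ f) (x + (0 : ℝ) • v) := by
      simpa using (hf.fderiv_right (m := 1) (by norm_num)).differentiableAt (by norm_num)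
    have h3 : HasDerivAt (fun s : ℝ => fderiv ℝ f (x + s • v))
        (fderiv ℝ (fderiv ℝ f) (x + (0 : ℝ) • v) v) 0 :=
      h2.hasFDerivAt.comp_hasDerivAt (0 : ℝ) (hl 0)
    have h4 := h3.clm_apply (hasDerivAt_const (0 : ℝ) v)
    rw [iteratedFDeriv_two_apply]
    simpa using h4

/-- Were the second derivative along `v` negative, the restriction to the line would have a local
maximum as well as a local minimum. It would be locally constant, with zero second derivative. -/
theorem iteratedFDeriv_two_nonneg_of_isLocalMin {f : E → ℝ} {x : E} (hf : ContDiffAt ℝ 2 f x)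
    (h : IsLocalMin f x) (v : E) : 0 ≤ iteratedFDeriv ℝ 2 f x ![v, v] := by
  obtain ⟨h1, h2⟩ := hasDerivAt_line_of_contDiffAt (v := v) hf
  set g : ℝ → ℝ := fun s => f (x + s • v) with hg
  have hd : deriv g =ᶠ[𝓝 0] fun s => fderiv ℝ f (x + s • v) v := h1.mono fun t ht => ht.deriv
  have hdd : deriv (deriv g) 0 = iteratedFDeriv ℝ 2 f x ![v, v] := by
    rw [hd.deriv_eq, h2.deriv]
  have ht : Filter.Tendsto (fun s : ℝ => x + s • v) (𝓝 0) (𝓝 x) := by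
    have : Continuous fun s : ℝ => x + s • v := by fun_prop
    simpa using this.tendsto 0
  have hmin : IsLocalMin g 0 := by
    have := ht.eventually h
    simpa [IsLocalMin, IsMinFilter, hg] using this
  by_contra! hneg
  have hmax : IsLocalMax g 0 := isLocalMax_of_deriv_deriv_neg (by rw [hdd]; exact hneg)
    hmin.deriv_eq_zero h1.self_of_nhds.continuousAt
  have hc : g =ᶠ[𝓝 0] fun _ => g 0 := by
    filter_upwards [hmin, hmax] with t h3 h4 using le_antisymm h4 h3
  have h5 : deriv g =ᶠ[𝓝 0] fun _ => 0 := by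
    filter_upwards [hc.eventuallyEq_nhds] with t h3
    rw [h3.deriv_eq, deriv_const]
  have := h5.deriv_eq
  rw [hdd, deriv_const] at this
  linarith

variable [FiniteDimensional ℝ E]

theorem laplacian_nonneg_of_isLocalMin {f : E → ℝ} {x : E} (hf : ContDiffAt ℝ 2 f x)
    (h : IsLocalMin f x) : 0 ≤ Δ f x := by
  rw [laplacian_eq_iteratedFDeriv_stdOrthonormalBasis]
  exact Finset.sum_nonneg fun i _ => iteratedFDeriv_two_nonneg_of_isLocalMin hf h _

/-- The Laplacian of a radial function, written as a function of the squared distance. -/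
theorem laplacian_radial {h h' : ℝ → ℝ} {c x : E} {h'' : ℝ}
    (hh : ContDiffAt ℝ 2 h (‖x - c‖ ^ 2))
    (h1 : ∀ᶠ s in 𝓝 (‖x - c‖ ^ 2), HasDerivAt h (h' s) s)
    (h2 : HasDerivAt h' h'' (‖x - c‖ ^ 2)) :
    Δ (fun y => h (‖y - c‖ ^ 2)) x =
      4 * ‖x - c‖ ^ 2 * h'' + 2 * Module.finrank ℝ E * h' (‖x - c‖ ^ 2) := by
  have hN : ContDiff ℝ 2 fun y : E => ‖y - c‖ ^ 2 := (contDiff_id.sub contDiff_const).norm_sq ℝ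
  have hf : ContDiffAt ℝ 2 (fun y => h (‖y - c‖ ^ 2)) x := hh.comp x hN.contDiffAt
  have key : ∀ v : E, ‖v‖ = 1 → iteratedFDeriv ℝ 2 (fun y => h (‖y - c‖ ^ 2)) x ![v, v] =
      4 * (inner ℝ v (x - c)) ^ 2 * h'' + 2 * h' (‖x - c‖ ^ 2) := by
    intro v hv
    obtain ⟨h3, h4⟩ := hasDerivAt_line_of_contDiffAt (v := v) hf
    set q : ℝ → ℝ := fun s => ‖x + s • v - c‖ ^ 2 with hq
    have hq' : ∀ s, q s = ‖x - c‖ ^ 2 + 2 * inner ℝ v (x - c) * s + s ^ 2 := fun s => by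
      have : x + s • v - c = (x - c) + s • v := by abel
      simp only [hq]
      rw [this, norm_add_sq_real, inner_smul_right, norm_smul, hv, real_inner_comm]
      simp; ring
    have hqd : ∀ s, HasDerivAt q (2 * inner ℝ v (x - c) + 2 * s) s := fun s => by
      rw [funext hq']
      have := (((hasDerivAt_id s).const_mul (2 * inner ℝ v (x - c))).const_add
        (‖x - c‖ ^ 2)).add (hasDerivAt_pow 2 s)
      simpa using! this
    have hq0 : q 0 = ‖x - c‖ ^ 2 := by simp [hq]
    have htend : Filter.Tendsto q (𝓝 0) (𝓝 (‖x - c‖ ^ 2)) := by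
      rw [← hq0]; exact (hqd 0).continuousAt.tendsto
    have h5 : (fun s : ℝ => fderiv ℝ (fun y => h (‖y - c‖ ^ 2)) (x + s • v) v) =ᶠ[𝓝 0]
        fun s => h' (q s) * (2 * inner ℝ v (x - c) + 2 * s) := by
      filter_upwards [h3, htend.eventually h1] with t h6 h7
      exact h6.unique (h7.comp t (hqd t))
    have h6 : HasDerivAt (fun s => h' (q s)) (h'' * (2 * inner ℝ v (x - c) + 2 * 0)) 0 :=
      HasDerivAt.comp (0 : ℝ) (by rw [hq0]; exact h2) (hqd 0)
    have h7 : HasDerivAt (fun s : ℝ => 2 * inner ℝ v (x - c) + 2 * s) 2 0 := by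
      simpa using ((hasDerivAt_id (0 : ℝ)).const_mul 2).const_add (2 * inner ℝ v (x - c))
    rw [h4.unique ((h6.mul h7).congr_of_eventuallyEq h5), hq0]
    ring
  rw [laplacian_eq_iteratedFDeriv_stdOrthonormalBasis]
  simp only
  rw [Finset.sum_congr rfl fun i _ => key _ ((stdOrthonormalBasis ℝ E).orthonormal.1 i),
    Finset.sum_add_distrib, ← Finset.sum_mul, ← Finset.mul_sum]
  have := (stdOrthonormalBasis ℝ E).sum_sq_norm_inner_right (x - c)
  simp only [Real.norm_eq_abs, sq_abs] at this
  rw [this]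
  simp
  ring

/-- Serves to recenter balls in `ℂ` and to move from `ℂ`, where polar coordinates are at hand, to
the Euclidean plane. -/
theorem laplacian_comp_add_linearIsometryEquiv {F : Type*} [NormedAddCommGroup F]
    [InnerProductSpace ℝ F] [FiniteDimensional ℝ F] (L : E ≃ₗᵢ[ℝ] F) (f : F → ℝ) (c : F) (x : E) :
    Δ (fun y => f (c + L y)) x = Δ f (c + L x) := by
  rw [laplacian_eq_iteratedFDeriv_orthonormalBasis _ (stdOrthonormalBasis ℝ E),
    laplacian_eq_iteratedFDeriv_orthonormalBasis _ ((stdOrthonormalBasis ℝ E).map L)]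
  refine Finset.sum_congr rfl fun i _ => ?_
  have h1 := L.toContinuousLinearEquiv.iteratedFDerivWithin_comp_right (𝕜 := ℝ)
    (fun z => f (c + z)) uniqueDiffOn_univ (mem_univ (L.toContinuousLinearEquiv x)) 2
  have h2 : (fun z => f (c + z)) ∘ L.toContinuousLinearEquiv = fun y => f (c + L y) := rfl
  rw [preimage_univ, iteratedFDerivWithin_univ, iteratedFDerivWithin_univ, h2] at h1
  rw [h1, iteratedFDeriv_comp_add_left]
  simp only [ContinuousMultilinearMap.compContinuousLinearMap_apply]
  congr 1
  ext j
  fin_cases j <;> rfl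

end Laplacian

/-! ### Circle means in the complex plane and the weak Harnack inequality. -/

section CircleMean

open InnerProductSpace Laplacian MeasureTheory Real

theorem hasDerivAt_intervalIntegral_of_continuous {F F' : ℝ → ℝ → ℝ} {a b : ℝ}
    (hF : Continuous (Function.uncurry F)) (hF' : Continuous (Function.uncurry F'))
    (h : ∀ r θ, HasDerivAt (fun s => F s θ) (F' r θ) r) (r : ℝ) :
    HasDerivAt (fun s => ∫ θ in a..b, F s θ) (∫ θ in a..b, F' r θ) r := by
  obtain ⟨C, hC⟩ := ((isCompact_closedBall r 1).prod (isCompact_uIcc (a := a) (b := b))).bddAbove_image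
    (f := fun p => ‖Function.uncurry F' p‖) hF'.norm.continuousOn
  have hc : ∀ s, Continuous (F s) := fun s => hF.comp (by fun_prop : Continuous fun θ => (s, θ))
  have hc' : ∀ s, Continuous (F' s) := fun s => hF'.comp (by fun_prop : Continuous fun θ => (s, θ))
  refine (intervalIntegral.hasDerivAt_integral_of_dominated_loc_of_deriv_le (F' := F')
    (bound := fun _ => C) (closedBall_mem_nhds r one_pos)
    (Filter.Eventually.of_forall fun s => (hc s).aestronglyMeasurable)
    ((hc r).intervalIntegrable _ _) (hc' r).aestronglyMeasurable
    (Filter.Eventually.of_forall fun θ hθ s hs => ?_) intervalIntegrable_const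
    (Filter.Eventually.of_forall fun θ _ s _ => h s θ)).2
  exact hC (mem_image_of_mem _ (mk_mem_prod hs (uIoc_subset_uIcc hθ)))

/-- The Laplacian on the complex plane, computed in a rotated orthonormal frame. -/
theorem laplacian_eq_rotated {w : ℂ → ℝ} {z : ℂ} (hw : ContDiffAt ℝ 2 w z) (θ : ℝ) :
    Δ w z = fderiv ℝ (fderiv ℝ w) z (Complex.exp (θ * Complex.I)) (Complex.exp (θ * Complex.I)) +
      fderiv ℝ (fderiv ℝ w) z (Complex.exp (θ * Complex.I) * Complex.I)
        (Complex.exp (θ * Complex.I) * Complex.I) := by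
  rw [laplacian_eq_iteratedFDeriv_complexPlane]
  simp only [iteratedFDeriv_two_apply]
  set D := fderiv ℝ (fderiv ℝ w) z
  have h1 : Complex.exp (θ * Complex.I) = cos θ • (1 : ℂ) + sin θ • Complex.I := by
    rw [Complex.exp_mul_I]; simp
  have h2 : Complex.exp (θ * Complex.I) * Complex.I = (-sin θ) • (1 : ℂ) + cos θ • Complex.I := by
    rw [h1]; simp [add_mul, mul_assoc]; ring
  rw [h2, h1]
  have h3 : D 1 Complex.I = D Complex.I 1 :=
    (hw.isSymmSndFDerivAt (by simp)).eq _ _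
  simp only [map_add, map_smul, add_apply, smul_apply,
    smul_eq_mul, Matrix.cons_val_zero, Matrix.cons_val_one, h3]
  linear_combination (-(D 1 1) - D Complex.I Complex.I) * (sin_sq_add_cos_sq θ)

theorem hasDerivAt_circle_radius (r θ : ℝ) :
    HasDerivAt (fun s : ℝ => (s : ℂ) * Complex.exp (θ * Complex.I))
      (Complex.exp (θ * Complex.I)) r := by
  simpa using (Complex.ofRealCLM.hasDerivAt (x := r)).mul_const (Complex.exp (θ * Complex.I))

theorem hasDerivAt_exp_angle (θ : ℝ) :
    HasDerivAt (fun t : ℝ => Complex.exp (t * Complex.I))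
      (Complex.exp (θ * Complex.I) * Complex.I) θ := by
  simpa using ((Complex.ofRealCLM.hasDerivAt (x := θ)).mul_const Complex.I).cexp

theorem hasDerivAt_circleIntegral {w : ℂ → ℝ} (hw : ContDiff ℝ 2 w) (r : ℝ) :
    HasDerivAt (fun s : ℝ => ∫ θ in (-π)..π, w (s * Complex.exp (θ * Complex.I)))
      (∫ θ in (-π)..π, fderiv ℝ w (r * Complex.exp (θ * Complex.I)) (Complex.exp (θ * Complex.I)))
      r := by
  have hD : Continuous (fderiv ℝ w) := hw.continuous_fderiv (by norm_num)
  have hc := hw.continuous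
  refine hasDerivAt_intervalIntegral_of_continuous
    (F := fun s θ => w (s * Complex.exp (θ * Complex.I)))
    (F' := fun s θ => fderiv ℝ w (s * Complex.exp (θ * Complex.I)) (Complex.exp (θ * Complex.I)))
    ?_ ?_ (fun s θ => ?_) r
  · simp only [Function.uncurry_def]; fun_prop
  · simp only [Function.uncurry_def]
    exact (hD.comp (by fun_prop)).clm_apply (by fun_prop)
  · exact (hw.differentiable (by norm_num) _).hasFDerivAt.comp_hasDerivAt s
      (hasDerivAt_circle_radius s θ)

/-- The polar form of the Laplacian, integrated over circles. -/
theorem hasDerivAt_mul_circleIntegral_fderiv {w : ℂ → ℝ} (hw : ContDiff ℝ 2 w) (r : ℝ) :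
    HasDerivAt (fun s : ℝ => s * ∫ θ in (-π)..π,
      fderiv ℝ w (s * Complex.exp (θ * Complex.I)) (Complex.exp (θ * Complex.I)))
      (r * ∫ θ in (-π)..π, Δ w (r * Complex.exp (θ * Complex.I))) r := by
  have hD1 : ContDiff ℝ 1 (fderiv ℝ w) := hw.fderiv_right (by norm_num)
  have hD : Continuous (fderiv ℝ w) := hD1.continuous
  have hDD : Continuous (fderiv ℝ (fderiv ℝ w)) := hD1.continuous_fderiv (by norm_num)
  have hdD : Differentiable ℝ (fderiv ℝ w) := hD1.differentiable (by norm_num)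
  set e : ℝ → ℂ := fun θ => Complex.exp (θ * Complex.I) with he
  have hec : Continuous e := by fun_prop
  have h1 := hasDerivAt_intervalIntegral_of_continuous (a := -π) (b := π)
    (F := fun s θ => fderiv ℝ w (s * e θ) (e θ))
    (F' := fun s θ => fderiv ℝ (fderiv ℝ w) (s * e θ) (e θ) (e θ))
    (by simp only [Function.uncurry_def]
        exact (hD.comp (by fun_prop)).clm_apply (by fun_prop))
    (by simp only [Function.uncurry_def]
        exact ((hDD.comp (by fun_prop)).clm_apply (by fun_prop)).clm_apply (by fun_prop))
    (fun s θ => by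
      have h2 : HasDerivAt (fun s : ℝ => fderiv ℝ w (s * e θ))
          (fderiv ℝ (fderiv ℝ w) (s * e θ) (e θ)) s :=
        (hdD _).hasFDerivAt.comp_hasDerivAt s (hasDerivAt_circle_radius s θ)
      simpa using h2.clm_apply (hasDerivAt_const s (e θ))) r
  have h2 := (hasDerivAt_id r).mul h1
  -- The tangential second derivative, up to the radial first derivative, is the `θ`-derivative of a
  -- `2π`-periodic function. It therefore drops out after integration over the circle.
  have hH : ∀ θ : ℝ, HasDerivAt (fun t : ℝ => fderiv ℝ w (r * e t) (e t * Complex.I))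
      (r * fderiv ℝ (fderiv ℝ w) (r * e θ) (e θ * Complex.I) (e θ * Complex.I)
        - fderiv ℝ w (r * e θ) (e θ)) θ := fun θ => by
    have h3 : HasDerivAt (fun t : ℝ => (r : ℂ) * e t) (r * (e θ * Complex.I)) θ :=
      (hasDerivAt_exp_angle θ).const_mul (r : ℂ)
    have h4 : HasDerivAt (fun t : ℝ => fderiv ℝ w (r * e t))
        (fderiv ℝ (fderiv ℝ w) (r * e θ) (r * (e θ * Complex.I))) θ :=
      (hdD _).hasFDerivAt.comp_hasDerivAt θ h3
    have h5 := h4.clm_apply ((hasDerivAt_exp_angle θ).mul_const Complex.I)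
    refine h5.congr_deriv ?_
    have h6 : (r : ℂ) * (e θ * Complex.I) = r • (e θ * Complex.I) := by simp
    have h7 : Complex.exp (θ * Complex.I) * Complex.I * Complex.I = - e θ := by
      rw [mul_assoc, Complex.I_mul_I]; simp [he]
    rw [h6, h7, map_smul, map_neg]
    simp [he, sub_eq_add_neg]
  have cA : Continuous fun θ => fderiv ℝ w (r * e θ) (e θ) :=
    (hD.comp (by fun_prop)).clm_apply (by fun_prop)
  have cB : Continuous fun θ => fderiv ℝ (fderiv ℝ w) (r * e θ) (e θ) (e θ) :=
    ((hDD.comp (by fun_prop)).clm_apply (by fun_prop)).clm_apply (by fun_prop)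
  have cC : Continuous fun θ =>
      fderiv ℝ (fderiv ℝ w) (r * e θ) (e θ * Complex.I) (e θ * Complex.I) :=
    ((hDD.comp (by fun_prop)).clm_apply (by fun_prop)).clm_apply (by fun_prop)
  have cC' : Continuous fun θ =>
      r * fderiv ℝ (fderiv ℝ w) (r * e θ) (e θ * Complex.I) (e θ * Complex.I) :=
    continuous_const.mul cC
  have h3 : ∫ θ in (-π)..π, (r * fderiv ℝ (fderiv ℝ w) (r * e θ) (e θ * Complex.I) (e θ * Complex.I)
        - fderiv ℝ w (r * e θ) (e θ)) = 0 := by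
    rw [intervalIntegral.integral_eq_sub_of_hasDerivAt (fun θ _ => hH θ)
      ((cC'.sub cA).intervalIntegrable _ _)]
    have : e (-π) = e π := by
      simp only [he]
      rw [Complex.exp_pi_mul_I]
      push_cast
      rw [neg_mul, Complex.exp_neg, Complex.exp_pi_mul_I]
      norm_num
    rw [this, sub_self]
  refine h2.congr_deriv ?_
  rw [intervalIntegral.integral_sub (cC'.intervalIntegrable _ _)
    (cA.intervalIntegrable _ _), intervalIntegral.integral_const_mul] at h3
  have h4 : ∀ θ : ℝ, Δ w (r * e θ) = fderiv ℝ (fderiv ℝ w) (r * e θ) (e θ) (e θ) +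
      fderiv ℝ (fderiv ℝ w) (r * e θ) (e θ * Complex.I) (e θ * Complex.I) := fun θ =>
    laplacian_eq_rotated hw.contDiffAt θ
  rw [intervalIntegral.integral_congr fun θ _ => h4 θ, intervalIntegral.integral_add (cB.intervalIntegrable _ _) (cC.intervalIntegrable _ _)]
  simp only [id, one_mul]
  linarith

/-- If `m` is the circle integral, then `(s m')' = s ∫ Δw ≥ -2πBs`. Integrating twice from `0`, in
the form of two monotone functions, gives the bound. -/
theorem circleIntegral_ge_of_contDiff {w : ℂ → ℝ} (hw : ContDiff ℝ 2 w) {d B : ℝ}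
    (h : ∀ s ∈ Ioo 0 d, -(2 * π * B) ≤ ∫ θ in (-π)..π, Δ w (s * Complex.exp (θ * Complex.I)))
    {r : ℝ} (hr : r ∈ Ico 0 d) :
    2 * π * (w 0 - B * r ^ 2 / 4) ≤ ∫ θ in (-π)..π, w (r * Complex.exp (θ * Complex.I)) := by
  set m := fun s : ℝ => ∫ θ in (-π)..π, w (s * Complex.exp (θ * Complex.I))
  set m' := fun s : ℝ => ∫ θ in (-π)..π,
    fderiv ℝ w (s * Complex.exp (θ * Complex.I)) (Complex.exp (θ * Complex.I))
  have hd : 0 < d := hr.1.trans_lt hr.2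
  have hq : ∀ s : ℝ, HasDerivAt (fun s => s * m' s + π * B * s ^ 2)
      (s * (∫ θ in (-π)..π, Δ w (s * Complex.exp (θ * Complex.I))) + π * B * (2 * s)) s :=
    fun s => by
      simpa using! (hasDerivAt_mul_circleIntegral_fderiv hw s).add
        ((hasDerivAt_pow 2 s).const_mul (π * B))
  have hp : ∀ s, HasDerivAt (fun s => m s + π * B / 2 * s ^ 2)
      (m' s + π * B / 2 * (2 * s)) s := fun s => by
    simpa using! (hasDerivAt_circleIntegral hw s).add ((hasDerivAt_pow 2 s).const_mul (π * B / 2))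
  have hmono : MonotoneOn (fun s => s * m' s + π * B * s ^ 2) (Ico 0 d) := by
    refine monotoneOn_of_deriv_nonneg (convex_Ico 0 d)
      (fun s _ => (hq s).continuousAt.continuousWithinAt)
      (fun s _ => (hq s).differentiableAt.differentiableWithinAt) fun s hs => ?_
    rw [interior_Ico] at hs
    rw [(hq s).deriv]
    nlinarith [h s hs, hs.1]
  have hmono2 : MonotoneOn (fun s => m s + π * B / 2 * s ^ 2) (Ico 0 d) := by
    refine monotoneOn_of_deriv_nonneg (convex_Ico 0 d)
      (fun s _ => (hp s).continuousAt.continuousWithinAt)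
      (fun s _ => (hp s).differentiableAt.differentiableWithinAt) fun s hs => ?_
    rw [interior_Ico] at hs
    rw [(hp s).deriv]
    have := hmono ⟨le_rfl, hd⟩ ⟨hs.1.le, hs.2⟩ hs.1.le
    simp only [zero_mul] at this
    have h3 : 0 ≤ s * (m' s + π * B / 2 * (2 * s)) := by nlinarith
    exact nonneg_of_mul_nonneg_right h3 hs.1
  have h4 := hmono2 ⟨le_rfl, hd⟩ hr hr.1
  have h5 : m 0 = 2 * π * w 0 := by simp [m]; left; ring
  simp only [h5] at h4
  simp only [m] at h4
  linarith

theorem contDiff_mul_of_contDiffOn_ball {v χ : ℂ → ℝ} {d d' : ℝ} (hd : d' < d)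
    (hv : ContDiffOn ℝ 2 v (ball 0 d)) (hχ : ContDiff ℝ 2 χ)
    (hs : tsupport χ ⊆ closedBall 0 d') : ContDiff ℝ 2 fun z => χ z * v z := by
  rw [contDiff_iff_contDiffAt]
  intro z
  by_cases hz : z ∈ ball (0 : ℂ) d
  · exact hχ.contDiffAt.mul (hv.contDiffAt (isOpen_ball.mem_nhds hz))
  · have h1 : z ∉ tsupport χ := fun h => hz (closedBall_subset_ball hd (hs h))
    have h2 : (fun z => χ z * v z) =ᶠ[𝓝 z] fun _ => 0 := by
      filter_upwards [notMem_tsupport_iff_eventuallyEq.mp h1] with y hy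
      simp [hy]
    exact contDiffAt_const.congr_of_eventuallyEq h2

theorem norm_circle (s θ : ℝ) : ‖(s : ℂ) * Complex.exp (θ * Complex.I)‖ = |s| := by
  rw [norm_mul, Complex.norm_exp_ofReal_mul_I]; simp

/-- A lower bound for circle means in terms of the value at the center. -/
theorem circleIntegral_ge {v : ℂ → ℝ} {d B : ℝ} (hv : ContDiffOn ℝ 2 v (ball 0 d))
    (h : ∀ s ∈ Ioo 0 d, -(2 * π * B) ≤ ∫ θ in (-π)..π, Δ v (s * Complex.exp (θ * Complex.I)))
    {r : ℝ} (hr : r ∈ Ico 0 d) :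
    2 * π * (v 0 - B * r ^ 2 / 4) ≤ ∫ θ in (-π)..π, v (r * Complex.exp (θ * Complex.I)) := by
  obtain ⟨d₁, h1, h1'⟩ := exists_between hr.2
  obtain ⟨d₂, h2, h2'⟩ := exists_between h1'
  have hd₁ : 0 < d₁ := hr.1.trans_lt h1
  -- The cutoff is `1` up to radius `d₁ > r` and is supported within radius `d₂ < d`. So `χ v` is
  -- `C²` on the whole plane and has the values and Laplacian of `v` on the circles that matter.
  let χ : ContDiffBump (0 : ℂ) := ⟨d₁, d₂, hd₁, h2⟩
  have hw : ContDiff ℝ 2 fun z => χ z * v z :=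
    contDiff_mul_of_contDiffOn_ball h2' hv χ.contDiff (by rw [χ.tsupport_eq])
  have heq : ∀ z ∈ ball (0 : ℂ) d₁, (fun z => χ z * v z) =ᶠ[𝓝 z] v := fun z hz => by
    filter_upwards [isOpen_ball.mem_nhds hz] with y hy
    rw [χ.one_of_mem_closedBall (ball_subset_closedBall hy), one_mul]
  have hmem : ∀ s ∈ Ico 0 d₁, ∀ θ : ℝ, (s : ℂ) * Complex.exp (θ * Complex.I) ∈ ball (0 : ℂ) d₁ :=
    fun s hs θ => by rw [mem_ball_zero_iff, norm_circle, abs_of_nonneg hs.1]; exact hs.2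
  have key := circleIntegral_ge_of_contDiff hw (d := d₁) (B := B) (fun s hs => ?_) ⟨hr.1, h1⟩
  · have h3 : ∀ θ : ℝ, (fun z => χ z * v z) (r * Complex.exp (θ * Complex.I)) =
        v (r * Complex.exp (θ * Complex.I)) := fun θ =>
      (heq _ (hmem r ⟨hr.1, h1⟩ θ)).self_of_nhds
    have h4 : (fun z => χ z * v z) 0 = v 0 := (heq 0 (mem_ball_self hd₁)).self_of_nhds
    simp only [h3, h4] at key
    exact key
  · have h3 : ∀ θ : ℝ, Δ (fun z => χ z * v z) (s * Complex.exp (θ * Complex.I)) =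
        Δ v (s * Complex.exp (θ * Complex.I)) := fun θ =>
      (laplacian_congr_nhds (heq _ (hmem s ⟨hs.1.le, hs.2⟩ θ))).self_of_nhds
    simp only [h3]
    exact h s ⟨hs.1, hs.2.trans h1'⟩

theorem continuousOn_laplacian {E : Type*} [NormedAddCommGroup E] [InnerProductSpace ℝ E]
    [FiniteDimensional ℝ E] {v : E → ℝ} {U : Set E} (hU : IsOpen U) (hv : ContDiffOn ℝ 2 v U) :
    ContinuousOn (Δ v) U := by
  rw [laplacian_eq_iteratedFDeriv_stdOrthonormalBasis]
  refine continuousOn_finsetSum _ fun i _ => ?_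
  have h1 : ContinuousOn (iteratedFDeriv ℝ 2 v) U := fun x hx =>
    ((hv.contDiffAt (hU.mem_nhds hx)).continuousAt_iteratedFDeriv
      (by norm_num)).continuousWithinAt
  exact ((ContinuousMultilinearMap.apply ℝ (fun _ : Fin 2 => E) ℝ _).continuous).comp_continuousOn h1

theorem continuous_comp_circle {g : ℂ → ℝ} {d : ℝ} (hg : ContinuousOn g (ball 0 d)) {s : ℝ}
    (hs : s ∈ Ico 0 d) : Continuous fun θ : ℝ => g (s * Complex.exp (θ * Complex.I)) := by
  refine hg.comp_continuous (by fun_prop) fun θ => ?_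
  rw [mem_ball_zero_iff, norm_circle, abs_of_nonneg hs.1]; exact hs.2

/-- Circle means of a superharmonic function are at most the value at the center. -/
theorem circleIntegral_le_of_superharmonic {v : ℂ → ℝ} {d : ℝ} (hv : ContDiffOn ℝ 2 v (ball 0 d))
    (h : ∀ z ∈ ball (0 : ℂ) d, Δ v z ≤ 0) {r : ℝ} (hr : r ∈ Ico 0 d) :
    ∫ θ in (-π)..π, v (r * Complex.exp (θ * Complex.I)) ≤ 2 * π * v 0 := by
  have := circleIntegral_ge (v := -v) (B := 0) hv.neg (fun s hs => ?_) hr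
  · simp only [Pi.neg_apply, intervalIntegral.integral_neg] at this
    linarith
  · simp only [laplacian_neg, Pi.neg_apply, intervalIntegral.integral_neg]
    have h1 : 0 ≤ ∫ θ in (-π)..π, -Δ v (s * Complex.exp (θ * Complex.I)) :=
      intervalIntegral.integral_nonneg (by linarith [pi_pos]) fun θ _ => by
        have := h (s * Complex.exp (θ * Complex.I)) (by
          rw [mem_ball_zero_iff, norm_circle, abs_of_pos hs.1]; exact hs.2)
        linarith
    rw [intervalIntegral.integral_neg] at h1
    linarith

/-- Superharmonicity bounds the circle mean of `v` by `v 0`, so the circle mean of `Δ v` is at least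
`-(A + K v 0)` even though `v` has no pointwise upper bound. -/
theorem circleIntegral_ge_of_linear_growth {v : ℂ → ℝ} {d A K : ℝ} (hK : 0 ≤ K)
    (hv : ContDiffOn ℝ 2 v (ball 0 d)) (h : ∀ z ∈ ball (0 : ℂ) d, Δ v z ≤ 0)
    (h' : ∀ z ∈ ball (0 : ℂ) d, -(A + K * v z) ≤ Δ v z) {r : ℝ} (hr : r ∈ Ico 0 d) :
    2 * π * (v 0 - (A + K * v 0) * r ^ 2 / 4) ≤
      ∫ θ in (-π)..π, v (r * Complex.exp (θ * Complex.I)) := by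
  refine circleIntegral_ge hv (fun s hs => ?_) hr
  have hs' : s ∈ Ico 0 d := ⟨hs.1.le, hs.2⟩
  have h1 := circleIntegral_le_of_superharmonic hv h hs'
  have c1 := continuous_comp_circle hv.continuousOn hs'
  have c3 : Continuous fun θ : ℝ => K * v (s * Complex.exp (θ * Complex.I)) :=
    continuous_const.mul c1
  have c2 := continuous_comp_circle (continuousOn_laplacian isOpen_ball hv) hs'
  have h2 : ∫ θ in (-π)..π, -(A + K * v (s * Complex.exp (θ * Complex.I))) ≤
      ∫ θ in (-π)..π, Δ v (s * Complex.exp (θ * Complex.I)) := by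
    refine intervalIntegral.integral_mono (by linarith [pi_pos])
      ((continuous_const.add c3).neg.intervalIntegrable _ _) (c2.intervalIntegrable _ _) fun θ => ?_
    exact h' _ (by rw [mem_ball_zero_iff, norm_circle, abs_of_pos hs.1]; exact hs.2)
  rw [intervalIntegral.integral_neg, intervalIntegral.integral_add (by simp)
    (c3.intervalIntegrable _ _), intervalIntegral.integral_const_mul,
    intervalIntegral.integral_const] at h2
  simp only [smul_eq_mul] at h2
  nlinarith

theorem integrableOn_polar_rectangle {v : ℂ → ℝ} {s : ℝ} (hv : ContinuousOn v (closedBall 0 s)) :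
    IntegrableOn (fun p : ℝ × ℝ => p.1 * v (p.1 * Complex.exp (p.2 * Complex.I)))
      (Ioo 0 s ×ˢ Ioo (-π) π) := by
  have hc : ContinuousOn (fun p : ℝ × ℝ => p.1 * v (p.1 * Complex.exp (p.2 * Complex.I)))
      (Icc 0 s ×ˢ Icc (-π) π) := by
    have h1 : Continuous fun p : ℝ × ℝ => (p.1 : ℂ) * Complex.exp (p.2 * Complex.I) := by fun_prop
    refine continuousOn_fst.mul (hv.comp h1.continuousOn fun p hp => ?_)
    rw [mem_closedBall_zero_iff, norm_circle, abs_of_nonneg hp.1.1]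
    exact hp.1.2
  exact (hc.integrableOn_compact (isCompact_Icc.prod isCompact_Icc)).mono_set
    (prod_mono Ioo_subset_Icc_self Ioo_subset_Icc_self)

theorem setIntegral_ball_eq_polar {v : ℂ → ℝ} {s : ℝ}
    (hv : ContinuousOn v (closedBall 0 s)) :
    IntegrableOn (fun r : ℝ => r * ∫ θ in (-π)..π, v (r * Complex.exp (θ * Complex.I))) (Ioo 0 s) ∧
    ∫ z in ball (0 : ℂ) s, v z =
      ∫ r : ℝ in Ioo 0 s, r * ∫ θ in (-π)..π, v (r * Complex.exp (θ * Complex.I)) := by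
  have hint := integrableOn_polar_rectangle hv
  have hin : ∀ r : ℝ, ∫ θ in Ioo (-π) π, r * v (r * Complex.exp (θ * Complex.I)) =
      r * ∫ θ in (-π)..π, v (r * Complex.exp (θ * Complex.I)) := fun r => by
    rw [integral_const_mul, intervalIntegral.integral_of_le (by linarith [pi_pos]),
      integral_Ioc_eq_integral_Ioo]
  constructor
  · rw [IntegrableOn, Measure.volume_eq_prod, ← Measure.prod_restrict] at hint
    have := hint.integral_prod_left
    simp only [hin] at this
    exact this
  · rw [← integral_indicator isOpen_ball.measurableSet, ← Complex.integral_comp_polarCoord_symm]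
    have h1 : ∀ p ∈ polarCoord.target, p.1 • (ball (0 : ℂ) s).indicator v
        (Complex.polarCoord.symm p) = (Ioo 0 s ×ˢ Ioo (-π) π).indicator
          (fun p : ℝ × ℝ => p.1 * v (p.1 * Complex.exp (p.2 * Complex.I))) p := by
      rintro ⟨r, θ⟩ ⟨hr, hθ⟩
      have h2 : Complex.polarCoord.symm (r, θ) = r * Complex.exp (θ * Complex.I) := by
        rw [Complex.polarCoord_symm_apply, Complex.exp_mul_I]; simp
      rw [h2]
      by_cases hrs : r < s
      · rw [indicator_of_mem, indicator_of_mem]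
        · rfl
        · exact ⟨⟨hr, hrs⟩, hθ⟩
        · rw [mem_ball_zero_iff, norm_circle, abs_of_pos hr]; exact hrs
      · rw [indicator_of_notMem, indicator_of_notMem, smul_zero]
        · exact fun h => hrs h.1.2
        · rw [mem_ball_zero_iff, norm_circle, abs_of_pos hr]; exact hrs
    rw [setIntegral_congr_fun polarCoord.open_target.measurableSet h1,
      setIntegral_indicator (measurableSet_Ioo.prod measurableSet_Ioo),
      inter_eq_self_of_subset_right (t := Ioo 0 s ×ˢ Ioo (-π) π)]
    · rw [Measure.volume_eq_prod, setIntegral_prod _ hint]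
      simp only [hin]
    · exact prod_mono Ioo_subset_Ioi_self subset_rfl

theorem integral_Ioo_mul_const {s : ℝ} (hs : 0 ≤ s) (c : ℝ) :
    ∫ r in Ioo 0 s, r * (2 * π * c) = π * s ^ 2 * c := by
  rw [← integral_Ioc_eq_integral_Ioo, ← intervalIntegral.integral_of_le hs,
    intervalIntegral.integral_mul_const, integral_id]
  ring

theorem integrableOn_Ioo_mul_const (s c : ℝ) :
    IntegrableOn (fun r : ℝ => r * (2 * π * c)) (Ioo 0 s) :=
  ((by fun_prop : Continuous fun r : ℝ => r * (2 * π * c)).continuousOn.integrableOn_compact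
    (isCompact_Icc (a := 0) (b := s))).mono_set Ioo_subset_Icc_self

/-- The area mean value inequality for superharmonic functions. -/
theorem setIntegral_ball_le_of_superharmonic {v : ℂ → ℝ} {d s : ℝ} (hs : 0 ≤ s) (hsd : s < d)
    (hv : ContDiffOn ℝ 2 v (ball 0 d)) (h : ∀ z ∈ ball (0 : ℂ) d, Δ v z ≤ 0) :
    ∫ z in ball (0 : ℂ) s, v z ≤ π * s ^ 2 * v 0 := by
  obtain ⟨h1, h2⟩ := setIntegral_ball_eq_polar
    (hv.continuousOn.mono (closedBall_subset_ball hsd))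
  rw [h2, ← integral_Ioo_mul_const hs]
  refine setIntegral_mono_on h1 (integrableOn_Ioo_mul_const _ _) measurableSet_Ioo fun r hr => ?_
  exact mul_le_mul_of_nonneg_left
    (circleIntegral_le_of_superharmonic hv h ⟨hr.1.le, hr.2.trans hsd⟩) hr.1.le

theorem setIntegral_ball_ge_of_linear_growth {v : ℂ → ℝ} {d s A K : ℝ} (hs : 0 ≤ s) (hsd : s < d)
    (hK : 0 ≤ K) (hv : ContDiffOn ℝ 2 v (ball 0 d)) (h : ∀ z ∈ ball (0 : ℂ) d, Δ v z ≤ 0)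
    (h' : ∀ z ∈ ball (0 : ℂ) d, -(A + K * v z) ≤ Δ v z) (h0 : 0 ≤ A + K * v 0) :
    π * s ^ 2 * (v 0 - (A + K * v 0) * s ^ 2 / 4) ≤ ∫ z in ball (0 : ℂ) s, v z := by
  obtain ⟨h1, h2⟩ := setIntegral_ball_eq_polar
    (hv.continuousOn.mono (closedBall_subset_ball hsd))
  rw [h2, ← integral_Ioo_mul_const hs]
  refine setIntegral_mono_on (integrableOn_Ioo_mul_const _ _) h1 measurableSet_Ioo fun r hr => ?_
  refine mul_le_mul_of_nonneg_left (le_trans ?_ (circleIntegral_ge_of_linear_growth hK hv h h'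
    ⟨hr.1.le, hr.2.trans hsd⟩)) hr.1.le
  have : r ^ 2 ≤ s ^ 2 := pow_le_pow_left₀ hr.1.le hr.2.le 2
  gcongr

/-- A weak Harnack inequality. -/
theorem weak_harnack_complex {v : ℂ → ℝ} {d s A K : ℝ} (hs : 0 < s) (hsd : 4 * s ≤ d)
    (hA : 0 ≤ A) (hK : 0 ≤ K) (hKs : K * s ^ 2 ≤ 1)
    (hv : ContDiffOn ℝ 2 v (ball 0 d)) (hpos : ∀ z ∈ ball (0 : ℂ) d, 0 ≤ v z)
    (h : ∀ z ∈ ball (0 : ℂ) d, Δ v z ≤ 0) (h' : ∀ z ∈ ball (0 : ℂ) d, -(A + K * v z) ≤ Δ v z)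
    {a : ℂ} (ha : ‖a‖ ≤ s) : (3 * v 0 - A * s ^ 2) / 16 ≤ v a := by
  have h0 : 0 ≤ v 0 := hpos 0 (mem_ball_self (by linarith))
  have h1 := setIntegral_ball_ge_of_linear_growth hs.le (by linarith) hK hv h h'
    (by positivity)
  have hsub : ball (0 : ℂ) (3 * s) ⊆ (fun z => a + z) ⁻¹' ball 0 d := fun z hz => by
    rw [mem_ball_zero_iff] at hz
    rw [mem_preimage, mem_ball_zero_iff]
    linarith [norm_add_le a z]
  have hv' : ContDiffOn ℝ 2 (fun z => v (a + z)) (ball 0 (3 * s)) :=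
    hv.comp (contDiff_const.add contDiff_id).contDiffOn hsub
  have h2 := setIntegral_ball_le_of_superharmonic (s := 2 * s) (by positivity) (by linarith) hv'
    (fun z hz => by
      have := laplacian_comp_add_linearIsometryEquiv (LinearIsometryEquiv.refl ℝ ℂ) v a z
      simp only [LinearIsometryEquiv.coe_refl, id] at this
      rw [this]
      exact h _ (hsub hz))
  have hball : (fun z => a + z) ⁻¹' ball a (2 * s) = ball 0 (2 * s) := by
    ext z; simp [mem_ball, dist_eq_norm]
  have h3 : ∫ z in ball (0 : ℂ) (2 * s), v (a + z) = ∫ z in ball a (2 * s), v z := by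
    rw [← hball]
    exact (measurePreserving_add_left volume a).setIntegral_preimage_emb
      (measurableEmbedding_addLeft a) v _
  have hsub2 : closedBall a (2 * s) ⊆ ball 0 d := fun z hz => by
    rw [mem_closedBall, dist_eq_norm] at hz
    rw [mem_ball_zero_iff]
    linarith [norm_sub_norm_le z a]
  -- As `‖a‖ ≤ s`, the ball of radius `s` around `0` lies in the ball of radius `2s` around `a`, and
  -- `v` is nonnegative there.
  have h4 : ∫ z in ball (0 : ℂ) s, v z ≤ ∫ z in ball a (2 * s), v z := by
    refine setIntegral_mono_set ?_ ?_ ?_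
    · exact ((hv.continuousOn.mono hsub2).integrableOn_compact
        (isCompact_closedBall _ _)).mono_set ball_subset_closedBall
    · filter_upwards [ae_restrict_mem isOpen_ball.measurableSet] with z hz
      exact hpos z (hsub2 (ball_subset_closedBall hz))
    · refine (ball_subset_ball' ?_).eventuallyLE
      rw [dist_zero_left]; linarith
  rw [h3] at h2
  simp only [add_zero] at h2
  have h5 : π * s ^ 2 * (v 0 - (A + K * v 0) * s ^ 2 / 4) ≤ π * s ^ 2 * (4 * v a) := by
    calc _ ≤ _ := h1
      _ ≤ _ := h4
      _ ≤ _ := h2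
      _ = _ := by ring
  -- The areas differ by a factor 4. With `K s² ≤ 1` the left side is at least `(3 v 0 - A s²) / 4`,
  -- whence the 16.
  have h6 := le_of_mul_le_mul_left h5 (by positivity)
  nlinarith

end CircleMean

/-! ### Geometry of `C²` boundaries: one-sidedness and the normal at a touching ball. -/

section Geometry

variable {n : ℕ} {Ω : Set (EuclideanSpace ℝ (Fin n))}

theorem hasDerivAt_line_gradient {ρ : EuclideanSpace ℝ (Fin n) → ℝ} {y : EuclideanSpace ℝ (Fin n)}
    (h : ContDiffAt ℝ 2 ρ y) (v : EuclideanSpace ℝ (Fin n)) :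
    HasDerivAt (fun t : ℝ => ρ (y + t • v)) (inner ℝ (gradient ρ y) v) 0 := by
  have h1 : HasFDerivAt ρ (InnerProductSpace.toDual ℝ _ (gradient ρ y)) (y + (0 : ℝ) • v) := by
    simpa using (h.differentiableAt (by norm_num)).hasGradientAt.hasFDerivAt
  have h2 : HasDerivAt (fun t : ℝ => y + t • v) v 0 := by
    simpa using ((hasDerivAt_id (0 : ℝ)).smul_const v).const_add y
  exact (h1.comp_hasDerivAt (0 : ℝ) h2).congr_deriv (InnerProductSpace.toDual_apply_apply ..)

theorem exists_pos_of_deriv_pos {g : ℝ → ℝ} {g' : ℝ} (hg : HasDerivAt g g' 0) (h0 : g 0 = 0)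
    (h : 0 < g') : ∀ᶠ t in 𝓝[>] 0, 0 < g t := by
  have h1 := (hasDerivAt_iff_tendsto_slope.mp hg).eventually (lt_mem_nhds h)
  have h2 : ∀ᶠ t in 𝓝[>] (0 : ℝ), 0 < slope g 0 t :=
    h1.filter_mono (nhdsWithin_mono _ fun t ht => (mem_Ioi.mp ht).ne')
  filter_upwards [h2, self_mem_nhdsWithin] with t ht ht0
  rw [slope_def_field, h0, sub_zero, sub_zero] at ht
  exact (div_pos_iff_of_pos_right ht0).mp ht

/-- A `C²` domain lies on one side of its boundary: it is the interior of its closure. -/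
theorem IsC2Domain.interior_closure_subset (hΩ : IsC2Domain Ω) : interior (closure Ω) ⊆ Ω := by
  intro z hz
  by_contra hzΩ
  have hzf : z ∈ frontier Ω := by
    rw [hΩ.isOpen.frontier_eq]; exact ⟨interior_subset hz, hzΩ⟩
  obtain ⟨ρ, hρ⟩ := hΩ.hasC2Boundary z hzf
  -- Along the gradient `ρ` becomes positive, so arbitrarily close to `z` there are points having a
  -- neighborhood free of `Ω`. This contradicts `z` being interior to the closure.
  have hder := hasDerivAt_line_gradient hρ.contDiffAt (gradient ρ z)
  have hpos : 0 < inner ℝ (gradient ρ z) (gradient ρ z) :=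
    real_inner_self_pos.mpr hρ.gradient_ne_zero
  have h1 := exists_pos_of_deriv_pos hder (by simpa using hρ.eq_zero) hpos
  have hc : Continuous fun t : ℝ => z + t • gradient ρ z := by fun_prop
  have ht : Filter.Tendsto (fun t : ℝ => z + t • gradient ρ z) (𝓝[>] 0) (𝓝 z) := by
    have := (hc.tendsto 0).mono_left (nhdsWithin_le_nhds (s := Ioi 0))
    simpa using this
  have h2 : ∀ᶠ y in 𝓝 z, ContDiffAt ℝ 2 ρ y := hρ.contDiffAt.eventually (by simp)
  obtain ⟨t, ht1, ht2, ht3, ht4⟩ := (h1.and ((ht.eventually h2).and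
    ((ht.eventually hρ.eventually_mem_iff.eventually_nhds).and
      (ht.eventually (mem_interior_iff_mem_nhds.mp hz))))).exists
  have h5 : ∀ᶠ y in 𝓝 (z + t • gradient ρ z), 0 < ρ y :=
    ht2.continuousAt.eventually (lt_mem_nhds ht1)
  obtain ⟨y, ⟨hy1, hy2⟩, hy3⟩ := mem_closure_iff_nhds.mp ht4 _ (h5.and ht3)
  exact absurd (hy2.mp hy3) (not_lt.mpr hy1.le)

/-- If a ball inside `Ω` touches `∂Ω` at `y`, its outer normal at `y` is that of `Ω`. -/
theorem IsC2Domain.isOuterUnitNormal_of_ball_subset (hΩ : IsC2Domain Ω)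
    {x y : EuclideanSpace ℝ (Fin n)} {d : ℝ} (hd : 0 < d) (hball : ball x d ⊆ Ω)
    (hy : y ∈ frontier Ω) (hxy : dist y x = d) : IsOuterUnitNormal Ω y (d⁻¹ • (y - x)) := by
  obtain ⟨ρ, hρ⟩ := hΩ.hasC2Boundary y hy
  refine ⟨ρ, hρ, ?_⟩
  set g := gradient ρ y
  set e := d⁻¹ • (y - x) with he
  have hnorm : ‖y - x‖ = d := by rw [← dist_eq_norm, hxy]
  have he1 : ‖e‖ = 1 := by
    rw [he, norm_smul, hnorm, norm_inv, Real.norm_of_nonneg hd.le, inv_mul_cancel₀ hd.ne']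
  have hyx : y - x = d • e := by rw [he, smul_inv_smul₀ hd.ne']
  clear_value e
  -- A direction with `⟨e, v⟩ < 0` enters the ball, hence `Ω`, so `ρ` cannot increase along it to
  -- first order.
  have key : ∀ v, inner ℝ e v < 0 → inner ℝ g v ≤ 0 := by
    intro v hv
    by_contra! hgv
    have h1 := exists_pos_of_deriv_pos (hasDerivAt_line_gradient hρ.contDiffAt v)
      (by simpa using hρ.eq_zero) hgv
    have hq : HasDerivAt (fun t : ℝ => d ^ 2 - ‖y + t • v - x‖ ^ 2) (-(2 * (d * inner ℝ e v))) 0 := by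
      have h2 : HasDerivAt (fun t : ℝ => y + t • v - x) v 0 := by
        simpa using (((hasDerivAt_id (0 : ℝ)).smul_const v).const_add y).sub_const x
      have h3 := (h2.norm_sq).const_sub (d ^ 2)
      simpa [hyx, inner_smul_left] using h3
    have h4 := exists_pos_of_deriv_pos hq (by simp [hnorm]) (by nlinarith)
    have hc : Continuous fun t : ℝ => y + t • v := by fun_prop
    have ht : Filter.Tendsto (fun t : ℝ => y + t • v) (𝓝[>] 0) (𝓝 y) := by
      have := (hc.tendsto 0).mono_left (nhdsWithin_le_nhds (s := Ioi 0))
      simpa using this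
    obtain ⟨t, ht1, ht2, ht3⟩ := (h1.and (h4.and (ht.eventually hρ.eventually_mem_iff))).exists
    have h5 : y + t • v ∈ ball x d := by
      rw [mem_ball, dist_eq_norm]
      exact lt_of_pow_lt_pow_left₀ 2 hd.le (by linarith)
    exact absurd (ht3.mp (hball h5)) (not_lt.mpr ht1.le)
  have h1 : 0 ≤ inner ℝ g e := by
    have := key (-e) (by rw [inner_neg_right, real_inner_self_eq_norm_sq, he1]; norm_num)
    rw [inner_neg_right] at this
    linarith
  -- `key` is tested on the part of `g` orthogonal to `e`, tilted by `-δ e` to make the inner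
  -- product with `e` strictly negative; `δ` is chosen so that the error is at most `ε`. This gives
  -- equality in Cauchy–Schwarz, so `g` is a nonnegative multiple of `e`.
  have h2 : ‖g‖ ^ 2 ≤ (inner ℝ g e) ^ 2 := by
    refine le_of_forall_pos_le_add fun ε hε => ?_
    set δ := ε / (1 + inner ℝ g e) with hδ
    have hδ0 : 0 < δ := by positivity
    have h3 := key (g - inner ℝ g e • e - δ • e) (by
      rw [inner_sub_right, inner_sub_right, inner_smul_right, inner_smul_right,
        real_inner_self_eq_norm_sq, he1, real_inner_comm]
      linarith)
    rw [inner_sub_right, inner_sub_right, inner_smul_right, inner_smul_right,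
      real_inner_self_eq_norm_sq] at h3
    have h4 : δ * (1 + inner ℝ g e) = ε := div_mul_cancel₀ _ (by positivity)
    nlinarith
  have h3 : ‖g‖ ≤ inner ℝ g e := le_of_sq_le_sq h2 h1
  have h4 : inner ℝ g e = ‖g‖ * ‖e‖ :=
    le_antisymm (real_inner_le_norm g e) (by rw [he1, mul_one]; exact h3)
  rw [inner_eq_norm_mul_iff_real, he1, one_smul] at h4
  calc e = ‖g‖⁻¹ • (‖g‖ • e) := (inv_smul_smul₀ (norm_ne_zero_iff.mpr hρ.gradient_ne_zero) e).symm
    _ = ‖g‖⁻¹ • g := by rw [← h4]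

end Geometry

/-! ### Nonexistence of large balls, in every dimension. -/

section NoBall

open InnerProductSpace Laplacian

variable {n : ℕ} {Ω : Set (EuclideanSpace ℝ (Fin n))}

theorem IsOverdeterminedSolution.contDiffOn_domain {f : ℝ → ℝ} {α : ℝ}
    {u : EuclideanSpace ℝ (Fin n) → ℝ} (hu : IsOverdeterminedSolution f Ω α u) :
    ContDiffOn ℝ 2 u Ω := hu.contDiffOn.mono subset_closure

theorem laplacian_sq_sub_norm_sq (R : ℝ) (c x : EuclideanSpace ℝ (Fin n)) :
    Δ (fun y => (R ^ 2 - ‖y - c‖ ^ 2) ^ 2) x =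
      8 * ‖x - c‖ ^ 2 - 4 * n * (R ^ 2 - ‖x - c‖ ^ 2) := by
  have h1 : ∀ s, HasDerivAt (fun s : ℝ => (R ^ 2 - s) ^ 2) (-2 * (R ^ 2 - s)) s := fun s => by
    refine (((hasDerivAt_id s).const_sub (R ^ 2)).pow 2).congr_deriv ?_
    simp
  have h2 : HasDerivAt (fun s : ℝ => -2 * (R ^ 2 - s)) 2 (‖x - c‖ ^ 2) := by
    refine (((hasDerivAt_id _).const_sub (R ^ 2)).const_mul (-2)).congr_deriv ?_
    norm_num
  rw [laplacian_radial (h := fun s => (R ^ 2 - s) ^ 2) (h' := fun s => -2 * (R ^ 2 - s))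
    (ContDiff.contDiffAt (by fun_prop)) (Filter.Eventually.of_forall h1) h2]
  simp
  ring

/-- A positive function with `Δu ≤ -λu` is not defined on large balls. -/
theorem not_closedBall_subset_of_laplacian_le {lam R : ℝ} (hlam : 0 < lam) (hR : 0 < R)
    (hRn : (4 * n + 8) ^ 2 < 32 * lam * R ^ 2) (hΩ : IsOpen Ω)
    {u : EuclideanSpace ℝ (Fin n) → ℝ} (hu : ContDiffOn ℝ 2 u Ω) (hpos : ∀ x ∈ Ω, 0 < u x)
    (hle : ∀ x ∈ Ω, Δ u x ≤ -(lam * u x)) (c : EuclideanSpace ℝ (Fin n)) :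
    ¬ closedBall c R ⊆ Ω := by
  intro hsub
  set φ : EuclideanSpace ℝ (Fin n) → ℝ := fun y => (R ^ 2 - ‖y - c‖ ^ 2) ^ 2 with hφ
  have hφc : ContDiff ℝ 2 φ :=
    (contDiff_const.sub ((contDiff_id.sub contDiff_const).norm_sq ℝ)).pow 2
  obtain ⟨x, hx, hmax⟩ := (isCompact_closedBall c R).exists_isMaxOn
    (nonempty_closedBall.mpr hR.le) (f := fun y => φ y / u y)
    (hφc.continuous.continuousOn.div (hu.continuousOn.mono hsub) fun y hy => (hpos y (hsub hy)).ne')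
  set s := φ x / u x with hs
  have hux := hpos x (hsub hx)
  have hle' : ∀ y ∈ closedBall c R, φ y ≤ s * u y := fun y hy =>
    (div_le_iff₀ (hpos y (hsub hy))).mp (hmax hy)
  have hs0 : 0 < s := by
    have h1 := hle' c (mem_closedBall_self hR.le)
    have h2 : 0 < φ c := by simp [hφ]; positivity
    exact pos_of_mul_pos_left (h2.trans_le h1) (hpos c (hsub (mem_closedBall_self hR.le))).le
  have hφx : φ x = s * u x := by rw [hs, div_mul_cancel₀ _ hux.ne']
  have hxR : ‖x - c‖ ≤ R := by simpa [dist_eq_norm] using hx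
  -- `φ` vanishes on the boundary sphere, so the maximum of `φ / u` is attained inside the ball.
  have hxlt : ‖x - c‖ < R := by
    refine lt_of_le_of_ne hxR fun h => ?_
    have : φ x = 0 := by simp [hφ, h]
    rw [hφx] at this
    exact (mul_pos hs0 hux).ne' this
  have hua : ContDiffAt ℝ 2 u x := hu.contDiffAt (hΩ.mem_nhds (hsub hx))
  have hmin : IsLocalMin (s • u - φ) x := by
    filter_upwards [isOpen_ball.mem_nhds (show x ∈ ball c R by simpa [dist_eq_norm] using hxlt)]
      with y hy
    have := hle' y (ball_subset_closedBall hy)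
    simp [hφx]
    exact this
  have hsu : ContDiffAt ℝ 2 (s • u) x := hua.const_smul s
  have h1 : 0 ≤ Δ (s • u - φ) x :=
    laplacian_nonneg_of_isLocalMin (hsu.sub hφc.contDiffAt) hmin
  rw [hsu.laplacian_sub hφc.contDiffAt, laplacian_smul s hua,
    laplacian_sq_sub_norm_sq, smul_eq_mul] at h1
  have h2 := mul_le_mul_of_nonneg_left (hle x (hsub hx)) hs0.le
  have h3 : s * (lam * u x) = lam * φ x := by rw [hφx]; ring
  simp only [hφ] at h3
  set q := R ^ 2 - ‖x - c‖ ^ 2 with hq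
  -- The inequality `0 ≤ s Δu - Δφ ≤ -λφ - Δφ` at `x`, written in `q`. The hypothesis `hRn` says
  -- that this quadratic has negative discriminant.
  have h4 : lam * q ^ 2 - (4 * n + 8) * q + 8 * R ^ 2 ≤ 0 := by
    have : ‖x - c‖ ^ 2 = R ^ 2 - q := by rw [hq]; ring
    rw [this] at h1
    linarith
  nlinarith [sq_nonneg (2 * lam * q - (4 * n + 8))]

theorem exists_radius_no_closedBall {f : ℝ → ℝ} (hf : HasLinearLowerBound f) (n : ℕ) :
    ∃ R > 0, ∀ Ω : Set (EuclideanSpace ℝ (Fin n)), IsFExtremal f Ω →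
      ClosureContainsNoClosedBall Ω R := by
  obtain ⟨lam, hlam, hf⟩ := hf
  set R := (4 * n + 8) * (1 / lam + 1) with hR
  -- The extra unit places the closed ball of radius `R` in the interior of `Ω̄`, which is contained
  -- in `Ω`.
  refine ⟨R + 1, by positivity, fun Ω hΩ c hc => ?_⟩
  obtain ⟨α, u, hu⟩ := hΩ.exists_solution
  refine not_closedBall_subset_of_laplacian_le hlam (show 0 < R by positivity) ?_
    hΩ.isC2Domain.isOpen hu.contDiffOn_domain hu.pos (fun x hx => ?_) c ?_
  · have h1 : lam * R ^ 2 = (4 * n + 8) ^ 2 * (1 / lam + 2 + lam) := by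
      rw [hR]; field_simp; ring
    have h2 : 0 < 1 / lam := by positivity
    have h3 : (0 : ℝ) < (4 * n + 8) ^ 2 := by positivity
    nlinarith
  · linarith [hu.equation x hx, hf (u x) (hu.pos x hx)]
  · calc closedBall c R ⊆ ball c (R + 1) := closedBall_subset_ball (by linarith)
      _ ⊆ interior (closedBall c (R + 1)) := ball_subset_interior_closedBall
      _ ⊆ interior (closure Ω) := interior_mono hc
      _ ⊆ Ω := hΩ.isC2Domain.interior_closure_subset

end NoBall

/-! ### Hopf estimate and boundedness of planar solutions. -/

section Boundedness

open InnerProductSpace Laplacian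

local notation "𝔼²" => EuclideanSpace ℝ (Fin 2)

/-- A weak Harnack inequality for nonnegative solutions of `-(A + K u) ≤ Δu ≤ 0` in the plane. -/
theorem weak_harnack {u : 𝔼² → ℝ} {x : 𝔼²} {d s A K : ℝ} (hs : 0 < s) (hsd : 4 * s ≤ d)
    (hA : 0 ≤ A) (hK : 0 ≤ K) (hKs : K * s ^ 2 ≤ 1)
    (hu : ContDiffOn ℝ 2 u (ball x d)) (hpos : ∀ z ∈ ball x d, 0 ≤ u z)
    (h : ∀ z ∈ ball x d, Δ u z ≤ 0) (h' : ∀ z ∈ ball x d, -(A + K * u z) ≤ Δ u z)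
    {a : 𝔼²} (ha : a ∈ closedBall x s) : (3 * u x - A * s ^ 2) / 16 ≤ u a := by
  let L : ℂ ≃ₗᵢ[ℝ] 𝔼² := Complex.orthonormalBasisOneI.repr
  have hmem : ∀ ζ ∈ ball (0 : ℂ) d, x + L ζ ∈ ball x d := fun ζ hζ => by
    simpa [dist_eq_norm] using hζ
  have hlap := laplacian_comp_add_linearIsometryEquiv L u x
  have hw := weak_harnack_complex (v := fun ζ => u (x + L ζ)) hs hsd hA hK hKs
    (hu.comp (contDiff_const.add L.contDiff).contDiffOn hmem)
    (fun ζ hζ => hpos _ (hmem ζ hζ)) (fun ζ hζ => by rw [hlap]; exact h _ (hmem ζ hζ))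
    (fun ζ hζ => by rw [hlap]; exact h' _ (hmem ζ hζ)) (a := L.symm (a - x))
    (by rw [LinearIsometryEquiv.norm_map, ← dist_eq_norm]; exact ha)
  simpa using hw

/-- In the plane this Laplacian is `4 |z - x|⁻⁴`. Its positivity makes the function usable as a
barrier from below. -/
theorem laplacian_inv_norm_sq {x z : 𝔼²} (hz : z ≠ x) :
    ContDiffAt ℝ 2 (fun y => (‖y - x‖ ^ 2)⁻¹) z ∧ 0 < Δ (fun y => (‖y - x‖ ^ 2)⁻¹) z := by
  have h0 : 0 < ‖z - x‖ ^ 2 := by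
    have := norm_pos_iff.mpr (sub_ne_zero.mpr hz); positivity
  have hN : ContDiff ℝ 2 fun y : 𝔼² => ‖y - x‖ ^ 2 := (contDiff_id.sub contDiff_const).norm_sq ℝ
  refine ⟨hN.contDiffAt.inv h0.ne', ?_⟩
  have h1 : ∀ᶠ s in 𝓝 (‖z - x‖ ^ 2), HasDerivAt (fun s : ℝ => s⁻¹) (-(s ^ 2)⁻¹) s := by
    filter_upwards [lt_mem_nhds h0] with s hs using hasDerivAt_inv hs.ne'
  have h2 := ((hasDerivAt_pow 2 (‖z - x‖ ^ 2)).inv (pow_ne_zero 2 h0.ne')).neg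
  rw [laplacian_radial (h := fun s => s⁻¹) (h' := fun s => -(s ^ 2)⁻¹)
    (contDiffAt_inv ℝ h0.ne') h1 h2]
  set q := ‖z - x‖ ^ 2
  have : 4 * q * -(-(((2 : ℕ) : ℝ) * q ^ (2 - 1)) / (q ^ 2) ^ 2) +
      2 * (Module.finrank ℝ 𝔼² : ℝ) * -(q ^ 2)⁻¹ = 4 / q ^ 2 := by
    simp only [finrank_euclideanSpace, Fintype.card_fin]
    field_simp
    push_cast
    ring
  rw [this]
  positivity

/-- Comparison of a superharmonic function with the barrier `|z - x|⁻² - d⁻²` on an annulus. -/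
theorem barrier_le_of_superharmonic {u : 𝔼² → ℝ} {x : 𝔼²} {d s m : ℝ} (hs : 0 < s)
    (hc : ContinuousOn u (closedBall x d)) (hu : ContDiffOn ℝ 2 u (ball x d))
    (hpos : ∀ z ∈ closedBall x d, 0 ≤ u z) (hlap : ∀ z ∈ ball x d, Δ u z < 0) (hm0 : 0 ≤ m)
    (hm : ∀ z ∈ closedBall x s, m ≤ u z) {z : 𝔼²} (hsz : s ≤ ‖z - x‖) (hzd : ‖z - x‖ ≤ d) :
    m * s ^ 2 * ((‖z - x‖ ^ 2)⁻¹ - (d ^ 2)⁻¹) ≤ u z := by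
  set ψ : 𝔼² → ℝ := fun y => (‖y - x‖ ^ 2)⁻¹ with hψ
  set S := closedBall x d ∩ {y | s ≤ ‖y - x‖} with hS
  have hcl : IsClosed {y : 𝔼² | s ≤ ‖y - x‖} := isClosed_le (by fun_prop) (by fun_prop)
  have hne : ∀ y ∈ S, y ≠ x := fun y hy h => by
    have : s ≤ ‖y - x‖ := hy.2
    rw [h, sub_self, norm_zero] at this
    linarith
  have hψc : ContinuousOn ψ S := fun y hy =>
    (laplacian_inv_norm_sq (hne y hy)).1.continuousAt.continuousWithinAt
  have hms : 0 ≤ m * s ^ 2 := by positivity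
  -- Minimum of `u - m s² ψ` over the annulus. On the outer circle the bound follows from `u ≥ 0`,
  -- and on the inner one from `u ≥ m = m s² ψ`. An interior minimum is excluded because the
  -- Laplacian of the difference is negative.
  obtain ⟨y, hy, hmin⟩ := ((isCompact_closedBall x d).inter_right hcl).exists_isMinOn
    (f := u - (m * s ^ 2) • ψ) ⟨z, by simpa [dist_eq_norm] using hzd, hsz⟩
    ((hc.mono inter_subset_left).sub (hψc.const_smul _))
  have hz' := hmin (show z ∈ S from ⟨by simpa [dist_eq_norm] using hzd, hsz⟩)
  simp only [mem_ofPred_eq, Pi.sub_apply, Pi.smul_apply, smul_eq_mul] at hz'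
  suffices h : -(m * s ^ 2 * (d ^ 2)⁻¹) ≤ u y - m * s ^ 2 * ψ y by
    simp only [hψ] at h hz' ⊢
    linarith
  have hyd : ‖y - x‖ ≤ d := by simpa [dist_eq_norm] using hy.1
  have hys : s ≤ ‖y - x‖ := hy.2
  rcases hyd.eq_or_lt with hyd' | hyd'
  · have h1 := hpos y hy.1
    simp only [hψ, hyd']
    linarith
  rcases hys.eq_or_lt with hys' | hys'
  · have h1 := hm y (by rw [mem_closedBall, dist_eq_norm]; exact hys'.ge)
    have h2 : m * s ^ 2 * ψ y = m := by
      simp only [hψ, ← hys']; field_simp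
    have h3 : 0 ≤ m * s ^ 2 * (d ^ 2)⁻¹ := by positivity
    linarith
  exfalso
  have hyb : y ∈ ball x d := by rw [mem_ball, dist_eq_norm]; exact hyd'
  have hloc : IsLocalMin (u - (m * s ^ 2) • ψ) y := by
    refine hmin.isLocalMin (Filter.inter_mem ?_ ?_)
    · exact Filter.mem_of_superset (isOpen_ball.mem_nhds hyb) ball_subset_closedBall
    · have h1 : IsOpen {y : 𝔼² | s < ‖y - x‖} := isOpen_lt (by fun_prop) (by fun_prop)
      exact Filter.mem_of_superset (h1.mem_nhds hys') fun w (hw : s < ‖w - x‖) => hw.le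
  obtain ⟨h1, h2⟩ := laplacian_inv_norm_sq (hne y hy)
  have h3 : ContDiffAt ℝ 2 u y := hu.contDiffAt (isOpen_ball.mem_nhds hyb)
  have h4 : ContDiffAt ℝ 2 ((m * s ^ 2) • ψ) y := contDiffAt_const.smul h1
  have h5 : 0 ≤ Δ (u - (m * s ^ 2) • ψ) y := laplacian_nonneg_of_isLocalMin (h3.sub h4) hloc
  have h6 : Δ (u - (m * s ^ 2) • ψ) y = Δ u y - (m * s ^ 2) * Δ ψ y := by
    rw [h3.laplacian_sub h4, laplacian_smul _ h1, smul_eq_mul]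
  rw [h6] at h5
  nlinarith [hlap y hyb, mul_nonneg hms h2.le]

/-- The Hopf boundary estimate at a point where an inner ball touches the boundary. -/
theorem IsOverdeterminedSolution.hopf {f : ℝ → ℝ} (hf : ∀ t > 0, 0 < f t) {Ω : Set 𝔼²}
    (hΩ : IsC2Domain Ω) {α : ℝ} {u : 𝔼² → ℝ} (hu : IsOverdeterminedSolution f Ω α u)
    {x y : 𝔼²} {d s m : ℝ} (hs : 0 < s) (hsd : s < d) (hball : ball x d ⊆ Ω)
    (hy : y ∈ frontier Ω) (hxy : dist y x = d) (hm0 : 0 ≤ m)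
    (hm : ∀ z ∈ closedBall x s, m ≤ u z) : 2 * m * s ^ 2 / d ^ 3 ≤ -α := by
  have hd : 0 < d := hs.trans hsd
  set e := d⁻¹ • (y - x) with he
  have hnorm : ‖y - x‖ = d := by rw [← dist_eq_norm, hxy]
  have hyx : y - x = d • e := by rw [he, smul_inv_smul₀ hd.ne']
  have he1 : ‖e‖ = 1 := by
    rw [he, norm_smul, hnorm, norm_inv, Real.norm_of_nonneg hd.le, inv_mul_cancel₀ hd.ne']
  have hα := hu.neumann y hy e (hΩ.isOuterUnitNormal_of_ball_subset hd hball hy hxy)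
  have hcl : closedBall x d ⊆ closure Ω := by
    rw [← closure_ball x hd.ne']; exact closure_mono hball
  have hlen : ∀ t ∈ Icc 0 d, ‖y - t • e - x‖ = d - t := fun t ht => by
    have : y - t • e - x = (d - t) • e := by rw [sub_smul, ← hyx]; abel
    rw [this, norm_smul, he1, mul_one, Real.norm_of_nonneg (by linarith [ht.2])]
  have hmaps : MapsTo (fun t : ℝ => y - t • e) (Ioo 0 (d - s)) (closure Ω) := fun t ht => by
    refine hcl ?_
    rw [mem_closedBall, dist_eq_norm, hlen t ⟨ht.1.le, by linarith [ht.2]⟩]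
    linarith [ht.1]
  have hdiff : HasFDerivWithinAt u (fderivWithin ℝ u (closure Ω) y) (closure Ω)
      (y - (0 : ℝ) • e) := by
    simpa using ((hu.contDiffOn y (frontier_subset_closure hy)).differentiableWithinAt
      (by norm_num)).hasFDerivWithinAt
  have hline : HasDerivWithinAt (fun t : ℝ => y - t • e) (-e) (Ioo 0 (d - s)) 0 := by
    simpa using (((hasDerivAt_id (0 : ℝ)).smul_const e).const_sub y).hasDerivWithinAt
  have hg : HasDerivWithinAt (fun t : ℝ => u (y - t • e)) (-α) (Ioo 0 (d - s)) 0 :=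
    (hdiff.comp_hasDerivWithinAt (0 : ℝ) hline hmaps).congr_deriv (by rw [map_neg, hα])
  have hb : HasDerivAt (fun t : ℝ => m * s ^ 2 * (((d - t) ^ 2)⁻¹ - (d ^ 2)⁻¹))
      (2 * m * s ^ 2 / d ^ 3) 0 := by
    have h1 : HasDerivAt (fun t : ℝ => (d - t) ^ 2) (-(2 * d)) 0 := by
      simpa using! ((hasDerivAt_id (0 : ℝ)).const_sub d).pow 2
    have h2 := ((h1.inv (by simpa using hd.ne')).sub_const ((d ^ 2)⁻¹)).const_mul (m * s ^ 2)
    refine h2.congr_deriv ?_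
    rw [sub_zero]
    field_simp
  -- Both `u` and the barrier vanish at `y` and `u` dominates along the inward normal, so the slopes
  -- at `t = 0` compare. The range `t < d - s` keeps the points in the annulus.
  have hsub := hg.sub hb.hasDerivWithinAt
  rw [hasDerivWithinAt_iff_tendsto_slope' (by simp)] at hsub
  have : (𝓝[Ioo 0 (d - s)] (0 : ℝ)).NeBot := left_nhdsWithin_Ioo_neBot (by linarith)
  have hnonneg := ge_of_tendsto hsub (b := 0) (by
    filter_upwards [self_mem_nhdsWithin] with t ht
    have h1 := barrier_le_of_superharmonic hs (hu.contDiffOn.continuousOn.mono hcl)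
      (hu.contDiffOn_domain.mono hball) (fun z hz => ?_) (fun z hz => ?_) hm0 hm
      (z := y - t • e) (by rw [hlen t ⟨ht.1.le, by linarith [ht.2]⟩]; linarith [ht.2])
      (by rw [hlen t ⟨ht.1.le, by linarith [ht.2]⟩]; linarith [ht.1])
    · rw [hlen t ⟨ht.1.le, by linarith [ht.2]⟩] at h1
      rw [slope_def_field]
      refine div_nonneg ?_ (by linarith [ht.1])
      simp [hu.dirichlet y hy]
      exact h1
    · by_cases hzΩ : z ∈ Ω
      · exact (hu.pos z hzΩ).le
      · exact (hu.dirichlet z (by rw [hΩ.isOpen.frontier_eq]; exact ⟨hcl hz, hzΩ⟩)).ge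
    · linarith [hu.equation z (hball hz), hf (u z) (hu.pos z (hball hz))])
  linarith

/-- If `f > 0` has at most linear growth and `Ω` contains no large balls, then every solution in
the plane is bounded. -/
theorem IsOverdeterminedSolution.apply_le {f : ℝ → ℝ} {A K : ℝ} (hA : 0 ≤ A) (hK : 0 ≤ K)
    (hf : ∀ t > 0, 0 < f t) (hfK : ∀ t > 0, f t ≤ A + K * t) {Ω : Set 𝔼²} (hΩ : IsC2Domain Ω)
    {R : ℝ} (hR : 0 < R) (hball : ClosureContainsNoClosedBall Ω R) {α : ℝ} {u : 𝔼² → ℝ}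
    (hu : IsOverdeterminedSolution f Ω α u) {x : 𝔼²} (hx : x ∈ Ω) :
    u x ≤ (A * R ^ 2 + 8 * (-α) * R * (4 + K * R ^ 2) ^ 2) / 3 := by
  have hcne : (Ωᶜ).Nonempty := by
    by_contra h
    rw [not_nonempty_iff_eq_empty, compl_empty_iff] at h
    exact hball x (by rw [h, closure_univ]; exact subset_univ _)
  -- A nearest point of the complement is where the largest ball around `x` inside `Ω` touches the
  -- boundary.
  obtain ⟨y, hyΩ, hy⟩ := hΩ.isOpen.isClosed_compl.exists_infDist_eq_dist hcne x
  set d := dist y x with hd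
  have hd0 : 0 < d := dist_pos.mpr fun h => hyΩ (h ▸ hx)
  have hsub : ball x d ⊆ Ω := fun z hz => by
    by_contra hzΩ
    have h1 : infDist x Ωᶜ ≤ dist x z := infDist_le_dist_of_mem hzΩ
    rw [hy, dist_comm x y, dist_comm x z] at h1
    exact absurd hz (by rw [mem_ball]; linarith)
  have hdR : d ≤ R := by
    by_contra! h
    exact hball x (((closedBall_subset_ball h).trans hsub).trans subset_closure)
  have hyf : y ∈ frontier Ω := by
    rw [hΩ.isOpen.frontier_eq]
    refine ⟨closure_mono hsub ?_, hyΩ⟩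
    rw [closure_ball x hd0.ne', mem_closedBall]
  -- This ratio of radii does not depend on `d`, and `s = θ d` satisfies both Harnack conditions, `4
  -- s ≤ d` and `K s² ≤ 1`, because `d ≤ R`.
  set θ := (4 + K * R ^ 2)⁻¹ with hθ
  have hKR : 0 ≤ K * R ^ 2 := by positivity
  have hθ0 : 0 < θ := by positivity
  have hθ1 : θ * (4 + K * R ^ 2) = 1 := inv_mul_cancel₀ (by positivity)
  have hθ4 : 4 * θ ≤ 1 := by nlinarith
  have hs : 0 < θ * d := by positivity
  have hdR2 : d ^ 2 ≤ R ^ 2 := pow_le_pow_left₀ hd0.le hdR 2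
  have hKs : K * (θ * d) ^ 2 ≤ 1 := by
    have h1 : K * d ^ 2 ≤ K * R ^ 2 := by gcongr
    have h2 : θ * (K * d ^ 2) ≤ 1 := by nlinarith
    calc K * (θ * d) ^ 2 = θ * (θ * (K * d ^ 2)) := by ring
      _ ≤ θ * 1 := by gcongr
      _ ≤ 1 := by linarith
  have hlap : ∀ z ∈ ball x d, Δ u z = -f (u z) := fun z hz => by
    linarith [hu.equation z (hsub hz)]
  have hm : ∀ z ∈ closedBall x (θ * d), (3 * u x - A * (θ * d) ^ 2) / 16 ≤ u z := fun z hz =>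
    weak_harnack hs (by nlinarith) hA hK hKs (hu.contDiffOn_domain.mono hsub)
      (fun w hw => (hu.pos w (hsub hw)).le)
      (fun w hw => by linarith [hlap w hw, hf _ (hu.pos w (hsub hw))])
      (fun w hw => by linarith [hlap w hw, hfK _ (hu.pos w (hsub hw))]) hz
  have hsR : A * (θ * d) ^ 2 ≤ A * R ^ 2 := by
    have : θ * d ≤ R := by nlinarith
    gcongr
  have hα : 0 ≤ -α := by linarith [hu.nonpos]
  set m := (3 * u x - A * (θ * d) ^ 2) / 16 with hmdef
  suffices h : m ≤ -α * R * (4 + K * R ^ 2) ^ 2 / 2 by linarith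
  rcases le_or_gt m 0 with h0 | h0
  · exact h0.trans (by positivity)
  have h1 := hu.hopf hf hΩ hs (by nlinarith) hsub hyf hd.symm h0.le hm
  have h2 : 2 * m * (θ * d) ^ 2 / d ^ 3 = 2 * m * θ ^ 2 / d := by
    field_simp
  rw [h2, div_le_iff₀ hd0] at h1
  -- The Hopf estimate bounds `2 m θ²` by `-α d`, and `d ≤ R`.
  have h3 : 2 * m * θ ^ 2 ≤ -α * R := h1.trans (by gcongr)
  have h4 : 2 * m * θ ^ 2 * (4 + K * R ^ 2) ^ 2 = 2 * m := by
    rw [mul_assoc, ← mul_pow, hθ1]; ring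
  have h5 : 2 * m * θ ^ 2 * (4 + K * R ^ 2) ^ 2 ≤ -α * R * (4 + K * R ^ 2) ^ 2 := by gcongr
  linarith

end Boundedness

/-! ### The main theorem. -/

theorem theorem2p3 (f : ℝ → ℝ) (hf : ∃ K : ℝ≥0, LipschitzOnWith K f (Ioi 0))
    (hf' : HasLinearLowerBound f) :
    (∀ Ω : Set (EuclideanSpace ℝ (Fin 2)), IsFExtremal f Ω →
      ∃ R > 0, ClosureContainsNoClosedBall Ω R ∧
        ∀ (α : ℝ) (u : EuclideanSpace ℝ (Fin 2) → ℝ), IsOverdeterminedSolution f Ω α u →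
          ∃ h₀ > 0, ∀ x ∈ {y ∈ Ω | h₀ < u y}, ∃ c,
            connectedComponentIn {y ∈ Ω | h₀ < u y} x ⊆ ball c (√5 / 2 * R)) ∧
    (∀ (n : ℕ) (Ω : Set (EuclideanSpace ℝ (Fin n))), IsFExtremal f Ω →
      ∃ R > 0, ClosureContainsNoClosedBall Ω R) := by
  refine ⟨fun Ω hΩ => ?_, fun n Ω hΩ => ?_⟩
  · obtain ⟨R, hR, hball⟩ := exists_radius_no_closedBall hf' 2
    obtain ⟨lam, hlam, hlow⟩ := hf'
    obtain ⟨K, hK⟩ := hf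
    have hpos : ∀ t > 0, 0 < f t := fun t ht => (mul_pos hlam ht).trans_le (hlow t ht)
    -- The Lipschitz condition is used against the base point `1`, since `0` is outside the domain
    -- of `f`.
    have hgrowth : ∀ t > 0, f t ≤ (f 1 + K) + K * t := fun t ht => by
      have h1 := hK.dist_le_mul t ht 1 (mem_Ioi.mpr one_pos)
      rw [Real.dist_eq, Real.dist_eq] at h1
      have h2 : |t - 1| ≤ t + 1 := by rw [abs_le]; constructor <;> linarith
      have h3 : (K : ℝ) * |t - 1| ≤ K * (t + 1) := by gcongr
      linarith [le_abs_self (f t - f 1)]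
    refine ⟨R, hR, hball Ω hΩ, fun α u hu => ?_⟩
    have hA : 0 ≤ f 1 + K := add_nonneg (hpos 1 one_pos).le K.2
    have hα : 0 ≤ -α := by linarith [hu.nonpos]
    set C := ((f 1 + K) * R ^ 2 + 8 * (-α) * R * (4 + K * R ^ 2) ^ 2) / 3 with hC
    have hC0 : 0 ≤ C := by positivity
    -- `u` is bounded by a constant that depends only on `f`, `α` and `R`, so that the superlevel
    -- sets have no components at all from that height on.
    refine ⟨C + 1, by positivity, fun x hx => ?_⟩
    have := hu.apply_le hA K.2 hpos hgrowth hΩ.isC2Domain hR (hball Ω hΩ) hx.1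
    have hx2 : C + 1 < u x := hx.2
    simp only [NNReal.val_eq_coe] at this
    linarith
  · obtain ⟨R, hR, hball⟩ := exists_radius_no_closedBall hf' n
    exact ⟨R, hR, hball Ω hΩ⟩
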